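/- A square linear space-time design of size $N\times N$ in $K$ real variables is a matrix $X=\sum_{k=1}^{K}x_kA_k$ whose weight matrices $A_1,\dots,A_K\in\mathbb{C}^{N\times N}$ are linearly independent over $\mathbb{R}$; its rate is $\frac{K}{2N}$ complex symbols per channel use. It is a unitary weight design (UWD) if every $A_k$ is unitary. It is $\lambda$-real-symbol (ML) decodable with $g$ groups if $K=g\lambda$ and the variables can be partitioned into $g$ groups of $\lambda$ variables each such that $A_k^HA_l+A_l^HA_k=0$ whenever $x_k$ and $x_l$ belong to different groups. Theorem. Let $a\ge 2$. Every 3-real-symbol decodable $2^a\times 2^a$ UWD has rate at most $\frac{3(a-1)}{2^a}$, and there is a 3-real-symbol decodable $2^a\times 2^a$ UWD whose rate is equal to $\frac{3(a-1)}{2^a}$. Equivalently, the largest number $g$ of groups of a 3-real-symbol decodable $2^a\times 2^a$ UWD is $2a-2$. -/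

import Mathlib

open scoped Matrix

/-- An `N × N` linear space-time design `∑ i, x i • A i` in the `K` real variables
`x 0, …, x (K - 1)`. It is given by its weight matrices `A i`, which are complex `N × N` matrices
that are linearly independent over `ℝ`. -/
structure LSTD (N K : ℕ) where
  /-- The weight matrices. -/
  weight : Fin K → Matrix (Fin N) (Fin N) ℂ
  /-- The weight matrices are linearly independent over the real numbers. -/
  linearIndependent : LinearIndependent ℝ weight

namespace LSTD

variable {N K : ℕ}

/-- The rate `K / (2 N)` of an `N × N` design in `K` real variables, in complex symbols per
channel use. -/
noncomputable def rate (_X : LSTD N K) : ℝ := (K : ℝ) / (2 * (N : ℝ))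

/-- Unitary weight design: every weight matrix is unitary. -/
def IsUnitaryWeight (X : LSTD N K) : Prop :=
  ∀ k, X.weight k ∈ Matrix.unitaryGroup (Fin N) ℂ

/-- The design is `g`-group decodable with `lam` real symbols per group: the `K` real variables
(equivalently, the weight matrices) can be partitioned into `g` groups of exactly `lam` elements
each such that `Aₖᴴ Aₗ + Aₗᴴ Aₖ = 0` whenever `Aₖ` and `Aₗ` belong to different groups.
Here `grp k` is the group of the `k`-th variable. -/
def IsGroupDecodable (X : LSTD N K) (g lam : ℕ) : Prop :=
  ∃ grp : Fin K → Fin g,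
    (∀ i, Fintype.card {k // grp k = i} = lam) ∧
    ∀ k l, grp k ≠ grp l →
      (X.weight k)ᴴ * X.weight l + (X.weight l)ᴴ * X.weight k = 0

/-- The design is `lam`-real-symbol (maximum likelihood) decodable: it is decodable in some number
of groups of `lam` real symbols each. -/
def IsRealSymbolDecodable (X : LSTD N K) (lam : ℕ) : Prop :=
  ∃ g, X.IsGroupDecodable g lam

end LSTD

/-! Upper bound: put `a = n + 1` and suppose there are at least `2 n + 1` groups. Left
multiplication by the adjoint of one weight matrix turns that matrix into `1`; representatives `B x`
of `2 n` other groups become anticommuting skew-Hermitian unitaries. They generate a full matrix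
algebra of size `2 ^ n`, whose commutant in size `2 ^ (n + 1)` is a copy of the 2 × 2 matrices. Each
element of the span of group `x` is `B x * M + i M'` (with `1` for `B x` in the normalised group),
where the Hermitian `M` commutes and the Hermitian `M'` anticommutes with every generator.
Orthogonality of two groups then says exactly that `M` commutes with `N` and `N'`, `M'` commutes
with `N`, and `M'` anticommutes with `N'`.

Compression by a minimal idempotent of rank two (`exists_clifford_idempotent`) is injective on these
pairs, so each group yields a real space, of dimension at least three, of pairs of Hermitian 2 × 2
matrices. `not_pairwise_pauliRel` excludes three such spaces, and `not_forall_three_le_finrank`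
combines the two steps.

Sharpness: with `a = k + 2`, the identity and `2 k + 1` anticommuting skew-Hermitian unitaries of
size `2 ^ k` form `2 a - 2` mutually orthogonal matrices; tensoring with three trace-orthogonal sign
diagonals of size four makes each of them a group of three. -/

/-! ### Real spaces of pairs of Hermitian 2 × 2 matrices, in Pauli coordinates. -/

theorem Submodule.finrank_le_finrank_map_fst_add {K V W : Type*} [Field K] [AddCommGroup V]
    [Module K V] [AddCommGroup W] [Module K W] [FiniteDimensional K V] [FiniteDimensional K W]
    (T : Submodule K (V × W)) :
    Module.finrank K T ≤ Module.finrank K (T.map (LinearMap.fst K V W)) +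
      Module.finrank K (T.comap (LinearMap.inr K V W)) := by
  have h := LinearMap.finrank_range_add_finrank_ker ((LinearMap.fst K V W).domRestrict T)
  rw [← h, LinearMap.range_domRestrict]
  gcongr
  let f : LinearMap.ker ((LinearMap.fst K V W).domRestrict T) →ₗ[K] W :=
    (LinearMap.snd K V W) ∘ₗ T.subtype ∘ₗ Submodule.subtype _
  have hf : ∀ x : LinearMap.ker ((LinearMap.fst K V W).domRestrict T),
      ((x : T) : V × W) = (0, f x) := by
    rintro ⟨⟨⟨v, w⟩, hT⟩, hx⟩
    have : v = 0 := by simpa using hx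
    simp [f, this]
  let f' := f.codRestrict (T.comap (LinearMap.inr K V W)) (fun x => by
    simp only [Submodule.mem_comap, LinearMap.inr_apply]
    rw [← hf x]
    exact (x : T).2)
  refine LinearMap.finrank_le_finrank_of_injective (f := f') ?_
  intro x y hxy
  have h1 : f x = f y := congrArg Subtype.val hxy
  ext1
  ext1
  rw [hf x, hf y, h1]

/-- Commutation of the Hermitian `2 × 2` matrices with Pauli coordinates `m` and `n`. -/
def PauliCommute (m n : Fin 4 → ℝ) : Prop :=
  m 1 * n 2 = m 2 * n 1 ∧ m 1 * n 3 = m 3 * n 1 ∧ m 2 * n 3 = m 3 * n 2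

/-- Anticommutation of the Hermitian `2 × 2` matrices with Pauli coordinates `m` and `n`. -/
def PauliAnticommute (m n : Fin 4 → ℝ) : Prop :=
  m 0 * n 0 + m 1 * n 1 + m 2 * n 2 + m 3 * n 3 = 0 ∧
    m 0 * n 1 + n 0 * m 1 = 0 ∧ m 0 * n 2 + n 0 * m 2 = 0 ∧ m 0 * n 3 + n 0 * m 3 = 0

theorem PauliCommute.symm {m n : Fin 4 → ℝ} (h : PauliCommute m n) : PauliCommute n m := by
  obtain ⟨h1, h2, h3⟩ := h
  refine ⟨?_, ?_, ?_⟩ <;> linarith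

theorem PauliAnticommute.symm {m n : Fin 4 → ℝ} (h : PauliAnticommute m n) :
    PauliAnticommute n m := by
  obtain ⟨h0, h1, h2, h3⟩ := h
  refine ⟨?_, ?_, ?_, ?_⟩ <;> linarith

/-- The relation between the Pauli coordinates of `(M, M')` and `(N, N')` that says that
`M` commutes with `N` and `N'`, that `M'` commutes with `N`, and that `M'` and `N'` anticommute. -/
structure PauliRel (x y : (Fin 4 → ℝ) × (Fin 4 → ℝ)) : Prop where
  fst_fst : PauliCommute x.1 y.1
  fst_snd : PauliCommute x.1 y.2
  snd_fst : PauliCommute x.2 y.1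
  snd_snd : PauliAnticommute x.2 y.2

theorem PauliRel.symm {x y : (Fin 4 → ℝ) × (Fin 4 → ℝ)} (h : PauliRel x y) : PauliRel y x :=
  ⟨h.1.symm, h.3.symm, h.2.symm, h.4.symm⟩

/-- The matrix with Pauli coordinates `m` is a scalar. -/
def PauliScalar (m : Fin 4 → ℝ) : Prop := m 1 = 0 ∧ m 2 = 0 ∧ m 3 = 0

/-- A plane contains a nonzero traceless matrix, and whatever anticommutes with it is traceless. -/
theorem apply_zero_eq_zero_of_pauliAnticommute {P Q : Submodule ℝ (Fin 4 → ℝ)}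
    (hP : 2 ≤ Module.finrank ℝ P) (h : ∀ m ∈ P, ∀ n ∈ Q, PauliAnticommute m n) :
    ∀ n ∈ Q, n 0 = 0 := by
  intro n hn
  let f : P →ₗ[ℝ] ℝ := (LinearMap.proj 0) ∘ₗ P.subtype
  have hk : LinearMap.ker f ≠ ⊥ := by
    apply LinearMap.ker_ne_bot_of_finrank_lt
    simp only [Module.finrank_self]
    omega
  obtain ⟨⟨m, hm⟩, hm0, hne⟩ := Submodule.exists_mem_ne_zero_of_ne_bot hk
  have h0 : m 0 = 0 := hm0
  obtain ⟨-, h1, h2, h3⟩ := h m hm n hn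
  by_contra hn0
  apply hne
  ext i
  simp only [h0, zero_mul, zero_add, mul_eq_zero, hn0, false_or] at h1 h2 h3
  fin_cases i <;> simp [h0, h1, h2, h3]

/-- Both spaces would be traceless and mutually orthogonal, hence two independent planes in a
three-dimensional space. -/
theorem not_forall_pauliAnticommute {P Q : Submodule ℝ (Fin 4 → ℝ)}
    (hP : 2 ≤ Module.finrank ℝ P) (hQ : 2 ≤ Module.finrank ℝ Q)
    (h : ∀ m ∈ P, ∀ n ∈ Q, PauliAnticommute m n) : False := by
  have hQ0 := apply_zero_eq_zero_of_pauliAnticommute hP h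
  have hP0 := apply_zero_eq_zero_of_pauliAnticommute hQ fun m hm n hn => (h n hn m hm).symm
  have hd : Disjoint P Q := by
    rw [Submodule.disjoint_def]
    intro m hm hm'
    have := (h m hm m hm').1
    have h0 : m 0 = 0 := by
      nlinarith [sq_nonneg (m 0), sq_nonneg (m 1), sq_nonneg (m 2), sq_nonneg (m 3)]
    have h1 : m 1 = 0 := by
      nlinarith [sq_nonneg (m 0), sq_nonneg (m 1), sq_nonneg (m 2), sq_nonneg (m 3)]
    have h2 : m 2 = 0 := by
      nlinarith [sq_nonneg (m 0), sq_nonneg (m 1), sq_nonneg (m 2), sq_nonneg (m 3)]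
    have h3 : m 3 = 0 := by
      nlinarith [sq_nonneg (m 0), sq_nonneg (m 1), sq_nonneg (m 2), sq_nonneg (m 3)]
    ext i
    fin_cases i <;> simp [h0, h1, h2, h3]
  have hsum := Submodule.finrank_sup_add_finrank_inf_eq P Q
  rw [hd.eq_bot, finrank_bot] at hsum
  have hle : Module.finrank ℝ (P ⊔ Q : Submodule ℝ (Fin 4 → ℝ)) ≤ 4 := by
    simpa using Submodule.finrank_le (P ⊔ Q)
  have htop : P ⊔ Q = ⊤ := by
    apply Submodule.eq_top_of_finrank_eq
    simp only [Module.finrank_fintype_fun_eq_card, Fintype.card_fin]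
    omega
  have hle' : P ⊔ Q ≤ LinearMap.ker (LinearMap.proj 0 : (Fin 4 → ℝ) →ₗ[ℝ] ℝ) :=
    sup_le (fun m hm => hP0 m hm) (fun m hm => hQ0 m hm)
  rw [htop] at hle'
  have : (Pi.single 0 1 : Fin 4 → ℝ) ∈ LinearMap.ker (LinearMap.proj 0 : (Fin 4 → ℝ) →ₗ[ℝ] ℝ) :=
    hle' trivial
  simp at this

/-- The first components fill at most a line, so the kernel of the first projection loses at most
one dimension. -/
theorem two_le_finrank_of_pauliScalar {T : Submodule ℝ ((Fin 4 → ℝ) × (Fin 4 → ℝ))}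
    (hT : 3 ≤ Module.finrank ℝ T) (hs : ∀ x ∈ T, PauliScalar x.1) :
    2 ≤ Module.finrank ℝ (T.comap (LinearMap.inr ℝ (Fin 4 → ℝ) (Fin 4 → ℝ))) := by
  have h := T.finrank_le_finrank_map_fst_add
  have h1 : T.map (LinearMap.fst ℝ (Fin 4 → ℝ) (Fin 4 → ℝ)) ≤
      Submodule.span ℝ {(Pi.single 0 1 : Fin 4 → ℝ)} := by
    rintro _ ⟨x, hx, rfl⟩
    rw [Submodule.mem_span_singleton]
    obtain ⟨h1, h2, h3⟩ := hs x hx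
    refine ⟨x.1 0, ?_⟩
    ext i
    fin_cases i <;> simp [h1, h2, h3]
  have h2 := (Submodule.finrank_mono h1).trans (finrank_span_le_card _)
  simp at h2
  omega

theorem PauliCommute.eq_smul {h m : Fin 4 → ℝ} (hh : ¬ PauliScalar h) (hm : PauliCommute h m) :
    ∃ t : ℝ, m 1 = t * h 1 ∧ m 2 = t * h 2 ∧ m 3 = t * h 3 := by
  obtain ⟨h1, h2, h3⟩ := hm
  by_cases a1 : h 1 = 0
  · by_cases a2 : h 2 = 0
    · have a3 : h 3 ≠ 0 := fun a3 => hh ⟨a1, a2, a3⟩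
      refine ⟨m 3 / h 3, ?_, ?_, ?_⟩ <;> field_simp <;> linarith
    · refine ⟨m 2 / h 2, ?_, ?_, ?_⟩ <;> field_simp <;> linarith
  · refine ⟨m 1 / h 1, ?_, ?_, ?_⟩ <;> field_simp <;> linarith

/-- The Hermitian matrices commuting with a nonscalar `k` are the combinations of `1` and `k`, which
commute with one another. -/
theorem PauliCommute.trans {h k m : Fin 4 → ℝ} (hk : ¬ PauliScalar k) (h1 : PauliCommute h k)
    (h2 : PauliCommute k m) : PauliCommute h m := by
  obtain ⟨s, a1, a2, a3⟩ := h1.symm.eq_smul hk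
  obtain ⟨t, b1, b2, b3⟩ := h2.eq_smul hk
  refine ⟨?_, ?_, ?_⟩ <;> simp only [a1, a2, a3, b1, b2, b3] <;> ring

/-- The first components lie in the plane spanned by `1` and `h`, so the first projection has a
kernel on `T`. -/
theorem exists_ne_zero_of_pauliCommute {T : Submodule ℝ ((Fin 4 → ℝ) × (Fin 4 → ℝ))}
    (hT : 3 ≤ Module.finrank ℝ T) {h : Fin 4 → ℝ} (hh : ¬ PauliScalar h)
    (hs : ∀ x ∈ T, PauliCommute h x.1) : ∃ m, m ≠ 0 ∧ (0, m) ∈ T := by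
  have hr := T.finrank_le_finrank_map_fst_add
  have h1 : T.map (LinearMap.fst ℝ (Fin 4 → ℝ) (Fin 4 → ℝ)) ≤
      Submodule.span ℝ {(Pi.single 0 1 : Fin 4 → ℝ), h} := by
    rintro _ ⟨x, hx, rfl⟩
    rw [Submodule.mem_span_pair]
    obtain ⟨t, h1, h2, h3⟩ := (hs x hx).eq_smul hh
    refine ⟨x.1 0 - t * h 0, t, ?_⟩
    ext i
    fin_cases i <;> simp [h1, h2, h3]
  have h2 := Submodule.finrank_mono h1
  have h3 : Module.finrank ℝ (Submodule.span ℝ {(Pi.single 0 1 : Fin 4 → ℝ), h}) ≤ 2 := by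
    classical
    have := finrank_span_finset_le_card (R := ℝ) {(Pi.single 0 1 : Fin 4 → ℝ), h}
    simp only [Finset.coe_insert, Finset.coe_singleton] at this
    exact this.trans Finset.card_le_two
  have h4 : T.comap (LinearMap.inr ℝ (Fin 4 → ℝ) (Fin 4 → ℝ)) ≠ ⊥ := by
    intro hb
    rw [hb, finrank_bot] at hr
    omega
  obtain ⟨m, hm, hne⟩ := Submodule.exists_mem_ne_zero_of_ne_bot h4
  exact ⟨m, hne, hm⟩

/-- At most two nonzero Hermitian `2 × 2` matrices that commute with a given nonscalar one can
anticommute pairwise. -/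
theorem not_pairwise_pauliAnticommute {h x y z : Fin 4 → ℝ} (hh : ¬ PauliScalar h)
    (hx : PauliCommute h x) (hy : PauliCommute h y) (hz : PauliCommute h z)
    (hx0 : x ≠ 0) (hy0 : y ≠ 0) (hz0 : z ≠ 0) (hxy : PauliAnticommute x y)
    (hxz : PauliAnticommute x z) (hyz : PauliAnticommute y z) : False := by
  have hpos : 0 < h 1 ^ 2 + h 2 ^ 2 + h 3 ^ 2 := by
    by_contra hc
    apply hh
    refine ⟨?_, ?_, ?_⟩ <;> nlinarith [sq_nonneg (h 1), sq_nonneg (h 2), sq_nonneg (h 3)]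
  set σ := Real.sqrt (h 1 ^ 2 + h 2 ^ 2 + h 3 ^ 2) with hσ
  have hσ2 : σ ^ 2 = h 1 ^ 2 + h 2 ^ 2 + h 3 ^ 2 := Real.sq_sqrt hpos.le
  have hσ0 : 0 < σ := Real.sqrt_pos.2 hpos
  -- In an eigenbasis of `h`, the matrix `m` is diagonal with entries `m 0 ± σ * s`; anticommuting
  -- diagonal matrices have product zero.
  have key : ∀ m n : Fin 4 → ℝ, ∀ s t : ℝ, (m 1 = s * h 1 ∧ m 2 = s * h 2 ∧ m 3 = s * h 3) →
      (n 1 = t * h 1 ∧ n 2 = t * h 2 ∧ n 3 = t * h 3) → PauliAnticommute m n →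
      (m 0 + σ * s) * (n 0 + σ * t) = 0 ∧ (m 0 - σ * s) * (n 0 - σ * t) = 0 := by
    rintro m n s t ⟨a1, a2, a3⟩ ⟨b1, b2, b3⟩ ⟨c0, c1, c2, c3⟩
    rw [a1, a2, a3, b1, b2, b3] at c0
    rw [a1, b1] at c1
    rw [a2, b2] at c2
    rw [a3, b3] at c3
    have d0 : m 0 * n 0 + σ ^ 2 * (s * t) = 0 := by rw [hσ2]; linarith
    have d1 : m 0 * t + n 0 * s = 0 := by
      have : (m 0 * t + n 0 * s) * (h 1 ^ 2 + h 2 ^ 2 + h 3 ^ 2) = 0 := by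
        linear_combination h 1 * c1 + h 2 * c2 + h 3 * c3
      exact (mul_eq_zero.1 this).resolve_right hpos.ne'
    constructor
    · linear_combination d0 + σ * d1
    · linear_combination d0 - σ * d1
  have nz : ∀ m : Fin 4 → ℝ, ∀ s : ℝ, (m 1 = s * h 1 ∧ m 2 = s * h 2 ∧ m 3 = s * h 3) →
      m 0 + σ * s = 0 → m 0 - σ * s = 0 → m = 0 := by
    rintro m s ⟨a1, a2, a3⟩ h1 h2
    have h0 : m 0 = 0 := by linarith
    have hs : s = 0 := by
      have : σ * s = 0 := by linarith
      exact (mul_eq_zero.1 this).resolve_left hσ0.ne'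
    ext i
    fin_cases i <;> simp [h0, a1, a2, a3, hs]
  obtain ⟨s, hs⟩ := hx.eq_smul hh
  obtain ⟨t, ht⟩ := hy.eq_smul hh
  obtain ⟨u, hu⟩ := hz.eq_smul hh
  obtain ⟨p1, q1⟩ := key x y s t hs ht hxy
  obtain ⟨p2, q2⟩ := key x z s u hs hu hxz
  obtain ⟨p3, q3⟩ := key y z t u ht hu hyz
  have ex := fun a b => hx0 (nz x s hs a b)
  have ey := fun a b => hy0 (nz y t ht a b)
  have ez := fun a b => hz0 (nz z u hu a b)
  -- Pigeonhole: at each of the two eigenvectors at most one of the three matrices has a nonzero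
  -- eigenvalue.
  simp only [mul_eq_zero] at p1 p2 p3 q1 q2 q3
  tauto

theorem not_pauliRel_of_scalar {T T' : Submodule ℝ ((Fin 4 → ℝ) × (Fin 4 → ℝ))}
    (hT : 3 ≤ Module.finrank ℝ T) (hT' : 3 ≤ Module.finrank ℝ T')
    (hs : ∀ x ∈ T, PauliScalar x.1) (hs' : ∀ x ∈ T', PauliScalar x.1)
    (hrel : ∀ x ∈ T, ∀ y ∈ T', PauliRel x y) : False :=
  not_forall_pauliAnticommute (two_le_finrank_of_pauliScalar hT hs)
    (two_le_finrank_of_pauliScalar hT' hs') fun m hm n hn => (hrel (0, m) hm (0, n) hn).snd_snd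

/-- The nonscalar `x.1` and `y.1` commute, so all first components of the three spaces commute with
`x.1`. Each space then contains some `(0, m)` with `m ≠ 0`, and these three `m` commute with `x.1`
and anticommute pairwise. -/
theorem not_pauliRel_of_nonscalar {T T' T'' : Submodule ℝ ((Fin 4 → ℝ) × (Fin 4 → ℝ))}
    (hT : 3 ≤ Module.finrank ℝ T) (hT' : 3 ≤ Module.finrank ℝ T')
    (hT'' : 3 ≤ Module.finrank ℝ T'') {x y : (Fin 4 → ℝ) × (Fin 4 → ℝ)} (hx : x ∈ T) (hy : y ∈ T')
    (hxs : ¬ PauliScalar x.1) (hys : ¬ PauliScalar y.1)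
    (h1 : ∀ x ∈ T, ∀ y ∈ T', PauliRel x y) (h2 : ∀ x ∈ T, ∀ y ∈ T'', PauliRel x y)
    (h3 : ∀ x ∈ T', ∀ y ∈ T'', PauliRel x y) : False := by
  have hxy := (h1 x hx y hy).fst_fst
  obtain ⟨m, hm0, hm⟩ := exists_ne_zero_of_pauliCommute hT hxs fun z hz =>
    hxy.trans hys (h1 z hz y hy).fst_fst.symm
  obtain ⟨n, hn0, hn⟩ := exists_ne_zero_of_pauliCommute hT' hxs fun z hz => (h1 x hx z hz).fst_fst
  obtain ⟨p, hp0, hp⟩ := exists_ne_zero_of_pauliCommute hT'' hxs fun z hz =>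
    (h2 x hx z hz).fst_fst
  exact not_pairwise_pauliAnticommute hxs (hxy.trans hys (h1 _ hm y hy).snd_fst.symm)
    (h1 x hx _ hn).fst_snd (h2 x hx _ hp).fst_snd hm0 hn0 hp0 (h1 _ hm _ hn).snd_snd
    (h2 _ hm _ hp).snd_snd (h3 _ hn _ hp).snd_snd

/-- Among three spaces, either two have only scalar first components or two have a nonscalar one. -/
theorem not_pairwise_pauliRel {T T' T'' : Submodule ℝ ((Fin 4 → ℝ) × (Fin 4 → ℝ))}
    (hT : 3 ≤ Module.finrank ℝ T) (hT' : 3 ≤ Module.finrank ℝ T')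
    (hT'' : 3 ≤ Module.finrank ℝ T'')
    (h1 : ∀ x ∈ T, ∀ y ∈ T', PauliRel x y) (h2 : ∀ x ∈ T, ∀ y ∈ T'', PauliRel x y)
    (h3 : ∀ x ∈ T', ∀ y ∈ T'', PauliRel x y) : False := by
  have h1' : ∀ y ∈ T', ∀ x ∈ T, PauliRel y x := fun y hy x hx => (h1 x hx y hy).symm
  have h2' : ∀ y ∈ T'', ∀ x ∈ T, PauliRel y x := fun y hy x hx => (h2 x hx y hy).symm
  have h3' : ∀ y ∈ T'', ∀ x ∈ T', PauliRel y x := fun y hy x hx => (h3 x hx y hy).symm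
  by_cases s : ∀ x ∈ T, PauliScalar x.1
  · by_cases s' : ∀ x ∈ T', PauliScalar x.1
    · exact not_pauliRel_of_scalar hT hT' s s' h1
    · by_cases s'' : ∀ x ∈ T'', PauliScalar x.1
      · exact not_pauliRel_of_scalar hT hT'' s s'' h2
      · push Not at s' s''
        obtain ⟨x, hx, hxs⟩ := s'
        obtain ⟨y, hy, hys⟩ := s''
        exact not_pauliRel_of_nonscalar hT' hT'' hT hx hy hxs hys h3 h1' h2'
  · push Not at s
    obtain ⟨x, hx, hxs⟩ := s
    by_cases s' : ∀ x ∈ T', PauliScalar x.1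
    · by_cases s'' : ∀ x ∈ T'', PauliScalar x.1
      · exact not_pauliRel_of_scalar hT' hT'' s' s'' h3
      · push Not at s''
        obtain ⟨y, hy, hys⟩ := s''
        exact not_pauliRel_of_nonscalar hT hT'' hT' hx hy hxs hys h2 h1 h3'
    · push Not at s'
      obtain ⟨y, hy, hys⟩ := s'
      exact not_pauliRel_of_nonscalar hT hT' hT'' hx hy hxs hys h1 h2 h3

/-! ### Projections and minimal idempotents of a Clifford algebra. -/

/-- A Hermitian idempotent with trace `d` is the orthogonal projection onto the span of `d`
orthonormal vectors, which are the columns of `V`. -/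
theorem Matrix.exists_eq_mul_conjTranspose_of_isIdempotent {m : Type*} [Fintype m] [DecidableEq m]
    {e : Matrix m m ℂ} {d : ℕ} (he : eᴴ = e) (hee : e * e = e) (ht : e.trace = d) :
    ∃ V : Matrix m (Fin d) ℂ, Vᴴ * V = 1 ∧ V * Vᴴ = e := by
  set f : EuclideanSpace ℂ m →ₗ[ℂ] EuclideanSpace ℂ m := Matrix.toEuclideanLin e with hf
  have hff : ∀ x, f (f x) = f x := by
    intro x
    simp only [hf, Matrix.toLpLin_apply, Matrix.mulVec_mulVec, hee]
  have hproj : LinearMap.IsProj (LinearMap.range f) f :=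
    ⟨fun x => ⟨x, rfl⟩, by rintro _ ⟨x, rfl⟩; exact hff x⟩
  have hrank : Module.finrank ℂ (LinearMap.range f) = d := by
    have h1 := hproj.trace
    have h2 : LinearMap.trace ℂ _ f = e.trace := by
      rw [hf, show Matrix.toEuclideanLin e = _ from congrArg (fun g => g e)
        (Matrix.toLpLin_eq_toLin 2 2), Matrix.trace_toLin_eq]
    rw [h2, ht] at h1
    exact_mod_cast h1.symm
  let b := (stdOrthonormalBasis ℂ (LinearMap.range f)).reindex (finCongr hrank)
  let V : Matrix m (Fin d) ℂ := fun i j => (b j : EuclideanSpace ℂ m) i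
  have hVV : Vᴴ * V = 1 := by
    ext i j
    have := orthonormal_iff_ite.1 b.orthonormal i j
    rw [Submodule.coe_inner, EuclideanSpace.inner_eq_star_dotProduct] at this
    rw [Matrix.one_apply, ← this]
    rw [Matrix.mul_apply]
    simp only [V, dotProduct, Pi.star_apply]
    exact Finset.sum_congr rfl fun _ _ => mul_comm _ _
  have heV : e * V = V := by
    ext i j
    have h1 : f (b j) = b j := hproj.map_id _ (b j).2
    have h2 := congrArg (fun v : EuclideanSpace ℂ m => v i) h1
    rw [Matrix.mul_apply]
    simpa [hf, Matrix.toLpLin_apply, Matrix.mulVec, dotProduct, V] using h2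
  have hC : ∃ C : Matrix (Fin d) m ℂ, e = V * C := by
    refine ⟨Matrix.of fun j k =>
      b.repr ⟨f (EuclideanSpace.single k 1), LinearMap.mem_range_self _ _⟩ j, ?_⟩
    ext i k
    have h1 := b.sum_repr ⟨f (EuclideanSpace.single k 1), LinearMap.mem_range_self _ _⟩
    have h2 := congrArg (fun v : LinearMap.range f => (v : EuclideanSpace ℂ m) i) h1
    simp only [Submodule.coe_sum, Submodule.coe_smul] at h2
    have h3 : f (EuclideanSpace.single k 1) i = e i k := by
      simp [hf, Matrix.toLpLin_apply]
    rw [← h3, ← h2, Matrix.mul_apply]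
    simp [V, mul_comm]
  obtain ⟨C, hC⟩ := hC
  refine ⟨V, hVV, ?_⟩
  have h1 : V * Vᴴ * e = e := by
    rw [hC, Matrix.mul_assoc, ← Matrix.mul_assoc Vᴴ, hVV, Matrix.one_mul]
  have h2 : Vᴴ * e = Vᴴ := by
    have := congrArg Matrix.conjTranspose heV
    rwa [Matrix.conjTranspose_mul, he] at this
  rw [← h1, Matrix.mul_assoc, h2]

/-- A minimal idempotent `e` for the Clifford algebra generated by the `2 n` matrices `B x`. -/
theorem exists_clifford_idempotent {m : Type*} [Fintype m] [DecidableEq m] (n : ℕ)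
    (B : Fin n × Bool → Matrix m m ℂ) (hsk : ∀ x, (B x)ᴴ = -B x) (hsq : ∀ x, B x * B x = -1)
    (hac : ∀ x y, x ≠ y → B x * B y = -(B y * B x)) :
    ∃ e : Matrix m m ℂ, eᴴ = e ∧ e * e = e ∧ 2 ^ n * e.trace = Fintype.card m ∧
      (∀ X, (∀ k, Commute X (B (k, true) * B (k, false))) → Commute X e) ∧
      (∀ X, ((∀ x, X * B x = B x * X) ∨ (∀ x, X * B x = -(B x * X))) → X * e = 0 → X = 0) := by
  induction n with
  | zero => exact ⟨1, by simp, by simp, by simp, fun X _ => Commute.one_right X, by simp⟩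
  | succ n ih =>
    obtain ⟨e, h1, h2, h3, h4, h5⟩ := ih (fun x => B (x.1.castSucc, x.2)) (fun x => hsk _)
      (fun x => hsq _) (fun x y hxy => hac _ _ (by
        simpa [Prod.ext_iff] using hxy))
    set P := B (Fin.last n, true) with hP
    set Q := B (Fin.last n, false) with hQ
    have hPP : P * P = -1 := hsq _
    have hQQ : Q * Q = -1 := hsq _
    have hPQ : P * Q = -(Q * P) := hac _ _ (by simp)
    -- `P` anticommutes with both factors of each earlier product, so the two signs cancel.
    have hPe : P * e = e * P := h4 P fun k => by
      have a1 := hac (Fin.last n, true) (k.castSucc, true) (by simp [Fin.ext_iff]; omega)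
      have a2 := hac (Fin.last n, true) (k.castSucc, false) (by simp)
      rw [Commute, SemiconjBy, hP]
      linear_combination (norm := noncomm_ring) a1 * B (k.castSucc, false) -
        B (k.castSucc, true) * a2
    have hQe : Q * e = e * Q := h4 Q fun k => by
      have a1 := hac (Fin.last n, false) (k.castSucc, true) (by simp)
      have a2 := hac (Fin.last n, false) (k.castSucc, false) (by simp [Fin.ext_iff]; omega)
      rw [Commute, SemiconjBy, hQ]
      linear_combination (norm := noncomm_ring) a1 * B (k.castSucc, false) -
        B (k.castSucc, true) * a2
    -- `E` is a Hermitian involution commuting with `e`; the new idempotent cuts `e` down to the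
    -- `+1` eigenspace of `E`.
    set E := Complex.I • (P * Q) with hE
    have hEE : E * E = 1 := by
      have : P * Q * (P * Q) = -1 := by
        linear_combination (norm := noncomm_ring) P * hPQ * Q - hPP * Q * Q + hQQ
      rw [hE, smul_mul_smul_comm, Complex.I_mul_I, this]
      simp
    have hEH : Eᴴ = E := by
      rw [hE, Matrix.conjTranspose_smul, Matrix.conjTranspose_mul, hP, hQ, hsk, hsk, ← hP, ← hQ,
        hPQ]
      simp
    have hEe : E * e = e * E := by
      rw [hE, smul_mul_assoc, mul_smul_comm, mul_assoc, hQe, ← mul_assoc, hPe, mul_assoc]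
    have hPE : P * E = -(E * P) := by
      rw [hE, mul_smul_comm, smul_mul_assoc, ← smul_neg]
      congr 1
      linear_combination (norm := noncomm_ring) P * hPQ
    refine ⟨(1 / 2 : ℂ) • (e + e * E), ?_, ?_, ?_, ?_, ?_⟩
    · rw [Matrix.conjTranspose_smul, Matrix.conjTranspose_add, Matrix.conjTranspose_mul, h1, hEH,
        hEe]
      simp
    · have : (e + e * E) * (e + e * E) = (2 : ℂ) • (e + e * E) := by
        rw [two_smul]
        linear_combination (norm := noncomm_ring) h2 + h2 * E + h2 * E + e * hEe + e * hEe * E +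
          e * e * hEE + h2
      rw [smul_mul_smul_comm, this, smul_smul]
      norm_num
    -- Conjugation by `P` fixes `e` and negates `E`, so both eigenspaces of `E` contribute equally
    -- and the trace halves.
    · have ht : (e * E).trace = 0 := by
        have a1 : P * (e * E) * P = e * E := by
          linear_combination (norm := noncomm_ring) hPe * E * P + e * hPE * P - e * E * hPP
        have a2 : (e * E).trace = -(e * E).trace := by
          conv_lhs => rw [← a1]
          rw [Matrix.trace_mul_comm, ← mul_assoc, hPP]
          simp
        exact self_eq_neg.1 a2
      rw [Matrix.trace_smul, Matrix.trace_add, ht, ← h3]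
      simp only [smul_eq_mul]
      ring
    · intro X hX
      have hXe : Commute X e := h4 X fun k => hX _
      have hXE : Commute X E := by
        rw [hE]
        exact (hX (Fin.last n)).smul_right _
      exact (hXe.add_right (hXe.mul_right hXE)).smul_right _
    · intro X hX h0
      have h0' : X * (e + e * E) = 0 := by
        rw [mul_smul_comm] at h0
        exact (smul_eq_zero.1 h0).resolve_left (by norm_num)
      refine h5 X (hX.imp (fun h x => h _) (fun h x => h _)) ?_
      -- Conjugating `X * (e + e * E) = 0` by `P` changes the sign of `E` and at most the sign of
      -- `X`.
      have key : X * e - X * e * E = 0 := by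
        rcases hX with hX | hX
        · have hXP : X * P = P * X := hX _
          linear_combination (norm := noncomm_ring) (-1) * P * h0' * P -
            hXP * (e + e * E) * P + X * hPe * (1 + E) * P + X * e * hPP + X * e * hPE * P -
            X * e * E * hPP
        · have hXP : X * P = -(P * X) := hX _
          linear_combination (norm := noncomm_ring) P * h0' * P -
            hXP * (e + e * E) * P + X * hPe * (1 + E) * P + X * e * hPP + X * e * hPE * P -
            X * e * E * hPP
      have : (2 : ℂ) • (X * e) = 0 := by
        rw [two_smul]
        linear_combination (norm := noncomm_ring) key + h0'
      exact (smul_eq_zero.1 this).resolve_left (by norm_num)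

/-! ### Separating terms by their commutation signs. -/

theorem eq_zero_of_mul_eq_zero_of_sq {R : Type*} [Ring R] {B x : R} (hB : B * B = -1)
    (h : B * x = 0) : x = 0 := by
  linear_combination (norm := noncomm_ring) hB * x - B * h

section Separation

variable {R : Type*} [Ring R] [Algebra ℂ R]

theorem eq_zero_of_add_self {x : R} (h : x + x = 0) : x = 0 := by
  rw [← two_smul ℂ] at h
  exact (smul_eq_zero.1 h).resolve_left two_ne_zero

/-- Elements with different commutation signs with respect to `B` and `B'` are independent. -/
theorem eq_zero_of_add_eq_zero_of_signs {B B' a b c d : R} (hB : B * B = -1) (hB' : B' * B' = -1)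
    (a1 : a * B = B * a) (a2 : a * B' = B' * a) (b1 : b * B = B * b) (b2 : b * B' = -(B' * b))
    (c1 : c * B = -(B * c)) (c2 : c * B' = B' * c) (d1 : d * B = -(B * d))
    (d2 : d * B' = -(B' * d)) (h : a + b + c + d = 0) : a = 0 ∧ b = 0 ∧ c = 0 ∧ d = 0 := by
  -- This is the relation `h` conjugated by `B`; conjugation by `B'` then separates each pair.
  have h1 : a + b - c - d = 0 := by
    linear_combination (norm := noncomm_ring) (-1) * B * h * B + B * (a1 + b1 + c1 + d1) +
      hB * (a + b - c - d)
  have hab : a + b = 0 := eq_zero_of_add_self (R := R) (by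
    linear_combination (norm := noncomm_ring) h + h1)
  have hcd : c + d = 0 := by linear_combination (norm := noncomm_ring) h - hab
  have hab' : a - b = 0 := by
    linear_combination (norm := noncomm_ring) (-1) * B' * hab * B' + B' * (a2 + b2) +
      hB' * (a - b)
  have hcd' : c - d = 0 := by
    linear_combination (norm := noncomm_ring) (-1) * B' * hcd * B' + B' * (c2 + d2) +
      hB' * (c - d)
  have ha : a = 0 := eq_zero_of_add_self (R := R) (by
    linear_combination (norm := noncomm_ring) hab + hab')
  have hc : c = 0 := eq_zero_of_add_self (R := R) (by
    linear_combination (norm := noncomm_ring) hcd + hcd')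
  exact ⟨ha, by simpa [ha] using hab, hc, by simpa [hc] using hcd⟩

/-- This serves the normalised group against another one, with `L`, `L'` standing for `i M'`, `i
N'`. The expanded relation has four terms, one for each pair of signs under `B` and `B'`, so each
vanishes. -/
theorem relations_of_add_mul_add {B B' M L N L' : R} (hB : B * B = -1) (hB' : B' * B' = -1)
    (hBB : B * B' = -(B' * B)) (m1 : M * B = B * M) (m2 : M * B' = B' * M) (n1 : N * B = B * N)
    (n2 : N * B' = B' * N) (l1 : L * B = -(B * L)) (l2 : L * B' = -(B' * L))
    (k1 : L' * B = -(B * L')) (k2 : L' * B' = -(B' * L'))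
    (h : (M - L) * (B * N + L') - (B * N + L') * (M + L) = 0) :
    M * N = N * M ∧ M * L' = L' * M ∧ L * N = N * L ∧ L * L' + L' * L = 0 := by
  have hsum : -(L * L' + L' * L) + B * (M * N - N * M) + B * (L * N - N * L) +
      (M * L' - L' * M) = 0 := by
    linear_combination (norm := noncomm_ring) h - m1 * N + l1 * N
  obtain ⟨e1, e2, e3, e4⟩ := eq_zero_of_add_eq_zero_of_signs hB hB'
    (by linear_combination (norm := noncomm_ring) (-1) * (L * k1 - l1 * L' + L' * l1 - k1 * L))
    (by linear_combination (norm := noncomm_ring) (-1) * (L * k2 - l2 * L' + L' * l2 - k2 * L))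
    (by linear_combination (norm := noncomm_ring) B * (M * n1 + m1 * N - N * m1 - n1 * M))
    (by linear_combination (norm := noncomm_ring) B * (M * n2 + m2 * N - N * m2 - n2 * M) +
          hBB * (M * N - N * M))
    (by linear_combination (norm := noncomm_ring) B * (L * n1 + l1 * N - N * l1 + n1 * L))
    (by linear_combination (norm := noncomm_ring) B * (L * n2 + l2 * N - N * l2 + n2 * L) -
          hBB * (L * N - N * L))
    (by linear_combination (norm := noncomm_ring) M * k1 + m1 * L' * (-1) - L' * m1 - k1 * M)
    (by linear_combination (norm := noncomm_ring) M * k2 - m2 * L' - L' * m2 - k2 * M) hsum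
  exact ⟨sub_eq_zero.1 (eq_zero_of_mul_eq_zero_of_sq hB e2), sub_eq_zero.1 e4,
    sub_eq_zero.1 (eq_zero_of_mul_eq_zero_of_sq hB e3), neg_eq_zero.1 e1⟩

/-- The same separation for two groups that are both represented by generators. -/
theorem relations_of_mul_add_mul_add {B B' M L N L' : R} (hB : B * B = -1) (hB' : B' * B' = -1)
    (hBB : B * B' = -(B' * B)) (m1 : M * B = B * M) (m2 : M * B' = B' * M) (n1 : N * B = B * N)
    (n2 : N * B' = B' * N) (l1 : L * B = -(B * L)) (l2 : L * B' = -(B' * L))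
    (k1 : L' * B = -(B * L')) (k2 : L' * B' = -(B' * L'))
    (h : (B * M + L) * (B' * N + L') + (B' * N + L') * (B * M + L) = 0) :
    M * N = N * M ∧ M * L' = L' * M ∧ L * N = N * L ∧ L * L' + L' * L = 0 := by
  have hsum : (L * L' + L' * L) + -(B' * (L * N - N * L)) + B * (M * L' - L' * M) +
      B * (B' * (M * N - N * M)) = 0 := by
    linear_combination (norm := noncomm_ring) h - l2 * N - k1 * M -
      B * m2 * N - B' * n1 * M - hBB * N * M
  obtain ⟨e1, e2, e3, e4⟩ := eq_zero_of_add_eq_zero_of_signs hB hB'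
    (by linear_combination (norm := noncomm_ring) (L * k1 - l1 * L' + L' * l1 - k1 * L))
    (by linear_combination (norm := noncomm_ring) (L * k2 - l2 * L' + L' * l2 - k2 * L))
    (by linear_combination (norm := noncomm_ring) (-1) * B' * (L * n1 + l1 * N - N * l1 + n1 * L) +
          hBB * (L * N - N * L))
    (by linear_combination (norm := noncomm_ring) (-1) * B' * (L * n2 + l2 * N - N * l2 + n2 * L))
    (by linear_combination (norm := noncomm_ring) B * (M * k1 - m1 * L' - L' * m1 - k1 * M))
    (by linear_combination (norm := noncomm_ring) B * (M * k2 - m2 * L' - L' * m2 - k2 * M) -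
          hBB * (M * L' - L' * M))
    (by linear_combination (norm := noncomm_ring)
          B * B' * (M * n1 + m1 * N - N * m1 - n1 * M) + B * hBB * (M * N - N * M))
    (by linear_combination (norm := noncomm_ring)
          B * B' * (M * n2 + m2 * N - N * m2 - n2 * M) + hBB * B' * (M * N - N * M)) hsum
  exact ⟨sub_eq_zero.1 (eq_zero_of_mul_eq_zero_of_sq hB' (eq_zero_of_mul_eq_zero_of_sq hB e4)),
    sub_eq_zero.1 (eq_zero_of_mul_eq_zero_of_sq hB e3),
    sub_eq_zero.1 (eq_zero_of_mul_eq_zero_of_sq hB' (neg_eq_zero.1 e2)), e1⟩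

end Separation

/-! ### From matrix relations to Pauli coordinates, and compression to size two. -/

/-- The coordinates of a Hermitian `2 × 2` matrix with respect to the Pauli basis. -/
noncomputable def pauliCoord : Matrix (Fin 2) (Fin 2) ℂ →ₗ[ℝ] (Fin 4 → ℝ) where
  toFun H := ![((H 0 0).re + (H 1 1).re) / 2, (H 0 1).re, (H 0 1).im,
    ((H 0 0).re - (H 1 1).re) / 2]
  map_add' H K := by
    ext i
    fin_cases i <;> simp <;> ring
  map_smul' c H := by
    ext i
    fin_cases i <;> simp <;> ring

theorem Matrix.re_im_of_conjTranspose_eq {H : Matrix (Fin 2) (Fin 2) ℂ} (hH : Hᴴ = H) :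
    (H 0 0).im = 0 ∧ (H 1 1).im = 0 ∧ (H 1 0).re = (H 0 1).re ∧ (H 1 0).im = -(H 0 1).im := by
  have h0 := congrFun₂ hH 0 0
  have h1 := congrFun₂ hH 1 1
  have h2 := congrFun₂ hH 1 0
  simp only [Matrix.conjTranspose_apply, Complex.star_def, Complex.ext_iff, Complex.conj_re,
    Complex.conj_im] at h0 h1 h2
  refine ⟨?_, ?_, h2.1.symm, h2.2.symm⟩ <;> linarith [h0.2, h1.2]

theorem eq_zero_of_pauliCoord_eq_zero {H : Matrix (Fin 2) (Fin 2) ℂ} (hH : Hᴴ = H)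
    (h : pauliCoord H = 0) : H = 0 := by
  obtain ⟨h0, h1, h2, h3⟩ := Matrix.re_im_of_conjTranspose_eq hH
  have e0 := congrFun h 0
  have e1 := congrFun h 1
  have e2 := congrFun h 2
  have e3 := congrFun h 3
  simp [pauliCoord] at e0 e1 e2 e3
  ext i j
  fin_cases i <;> fin_cases j <;> simp [Complex.ext_iff, *] <;> linarith

theorem pauliCommute_of_mul_eq {H K : Matrix (Fin 2) (Fin 2) ℂ} (hH : Hᴴ = H) (hK : Kᴴ = K)
    (h : H * K = K * H) : PauliCommute (pauliCoord H) (pauliCoord K) := by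
  obtain ⟨h0, h1, h2, h3⟩ := Matrix.re_im_of_conjTranspose_eq hH
  obtain ⟨k0, k1, k2, k3⟩ := Matrix.re_im_of_conjTranspose_eq hK
  have e0 := congrFun₂ h 0 0
  have e1 := congrFun₂ h 0 1
  simp only [Matrix.mul_apply, Fin.sum_univ_two, Complex.ext_iff, Complex.add_re, Complex.add_im,
    Complex.mul_re, Complex.mul_im, h0, h1, h2, h3, k0, k1, k2, k3] at e0 e1
  obtain ⟨a1, a2⟩ := e0
  obtain ⟨a3, a4⟩ := e1
  refine ⟨?_, ?_, ?_⟩ <;> simp [pauliCoord] <;> linarith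

theorem pauliAnticommute_of_mul_add_mul {H K : Matrix (Fin 2) (Fin 2) ℂ} (hH : Hᴴ = H)
    (hK : Kᴴ = K) (h : H * K + K * H = 0) :
    PauliAnticommute (pauliCoord H) (pauliCoord K) := by
  obtain ⟨h0, h1, h2, h3⟩ := Matrix.re_im_of_conjTranspose_eq hH
  obtain ⟨k0, k1, k2, k3⟩ := Matrix.re_im_of_conjTranspose_eq hK
  have e0 := congrFun₂ h 0 0
  have e1 := congrFun₂ h 0 1
  have e2 := congrFun₂ h 1 1
  simp only [Matrix.add_apply, Matrix.zero_apply, Complex.zero_re, Complex.zero_im,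
    Matrix.mul_apply, Fin.sum_univ_two, Complex.ext_iff, Complex.add_re, Complex.add_im,
    Complex.mul_re, Complex.mul_im, h0, h1, h2, h3, k0, k1, k2, k3] at e0 e1 e2
  obtain ⟨a1, a2⟩ := e0
  obtain ⟨a3, a4⟩ := e1
  obtain ⟨a5, a6⟩ := e2
  refine ⟨?_, ?_, ?_, ?_⟩ <;> simp [pauliCoord] <;> linarith

/-- A matrix commuting with the projection `V * Vᴴ` preserves the column space of `V`, so
compression is restriction there. -/
theorem compress_mul {m : Type*} [Fintype m]
    {V : Matrix m (Fin 2) ℂ} (hV : Vᴴ * V = 1) {X Y : Matrix m m ℂ}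
    (hY : Commute Y (V * Vᴴ)) : Vᴴ * (X * Y) * V = (Vᴴ * X * V) * (Vᴴ * Y * V) := by
  have h : V * Vᴴ * Y * V = Y * V := by
    rw [← hY.eq, Matrix.mul_assoc, Matrix.mul_assoc, hV, Matrix.mul_one]
  simp only [Matrix.mul_assoc] at h ⊢
  rw [h]

theorem conjTranspose_compress {m : Type*} [Fintype m]
    {V : Matrix m (Fin 2) ℂ} {X : Matrix m m ℂ} (hX : Xᴴ = X) :
    (Vᴴ * X * V)ᴴ = Vᴴ * X * V := by
  simp [hX, Matrix.mul_assoc]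

/-! ### Splitting the groups along the Clifford generators. -/

section PauliPairs

variable {m ι : Type*} [Fintype m]

/-- Pairs of a Hermitian matrix that commutes with all `B x` and a Hermitian matrix that
anticommutes with all `B x`. -/
def hermitianPairs (B : ι → Matrix m m ℂ) : Submodule ℝ (Matrix m m ℂ × Matrix m m ℂ) where
  carrier := {p | p.1ᴴ = p.1 ∧ p.2ᴴ = p.2 ∧ (∀ x, p.1 * B x = B x * p.1) ∧
    ∀ x, p.2 * B x = -(B x * p.2)}
  zero_mem' := by simp
  add_mem' := by
    rintro p q ⟨h1, h2, h3, h4⟩ ⟨k1, k2, k3, k4⟩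
    refine ⟨by simp [h1, k1], by simp [h2, k2], fun x => ?_, fun x => ?_⟩
    · simp [add_mul, mul_add, h3, k3]
    · simp [add_mul, mul_add, h4, k4, add_comm]
  smul_mem' := by
    rintro c p ⟨h1, h2, h3, h4⟩
    refine ⟨by simp [h1], by simp [h2], fun x => ?_, fun x => ?_⟩
    · simp [h3]
    · simp [h4]

/-- The map `(M, M') ↦ β M + i M'`. -/
noncomputable def combinePair (β : Matrix m m ℂ) :
    Matrix m m ℂ × Matrix m m ℂ →ₗ[ℝ] Matrix m m ℂ where
  toFun p := β * p.1 + Complex.I • p.2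
  map_add' p q := by
    simp only [Prod.fst_add, Prod.snd_add, mul_add, smul_add]
    abel
  map_smul' c p := by
    simp only [Prod.smul_fst, Prod.smul_snd, mul_smul_comm, RingHom.id_apply, smul_add]
    rw [smul_comm c Complex.I]

/-- Pauli coordinates of the compression `Vᴴ X V`. -/
noncomputable def compressCoord (V : Matrix m (Fin 2) ℂ) : Matrix m m ℂ →ₗ[ℝ] (Fin 4 → ℝ) where
  toFun X := pauliCoord (Vᴴ * X * V)
  map_add' X Y := by rw [Matrix.mul_add, Matrix.add_mul, map_add]
  map_smul' c X := by simp

variable {n : ℕ} {B : Fin n × Bool → Matrix m m ℂ} {V : Matrix m (Fin 2) ℂ}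

/-- Since `X` commutes with the projection, `X * (V * Vᴴ)` is recovered as `V * (Vᴴ * X * V) * Vᴴ`.
-/
theorem eq_zero_of_compressCoord_eq_zero (hV : Vᴴ * V = 1)
    {X : Matrix m m ℂ} (hX : Xᴴ = X) (hXe : Commute X (V * Vᴴ))
    (hf : X * (V * Vᴴ) = 0 → X = 0) (h : compressCoord V X = 0) : X = 0 := by
  apply hf
  have h0 : Vᴴ * X * V = 0 := eq_zero_of_pauliCoord_eq_zero (conjTranspose_compress hX) h
  calc X * (V * Vᴴ) = X * (V * (Vᴴ * V) * Vᴴ) := by rw [hV, Matrix.mul_one]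
    _ = X * (V * Vᴴ) * (V * Vᴴ) := by simp only [Matrix.mul_assoc]
    _ = V * (Vᴴ * X * V) * Vᴴ := by rw [hXe.eq]; simp only [Matrix.mul_assoc]
    _ = 0 := by rw [h0]; simp

theorem compressCoord_commute (hV : Vᴴ * V = 1) {X Y : Matrix m m ℂ} (hX : Xᴴ = X) (hY : Yᴴ = Y)
    (hXe : Commute X (V * Vᴴ)) (hYe : Commute Y (V * Vᴴ)) (h : X * Y = Y * X) :
    PauliCommute (compressCoord V X) (compressCoord V Y) := by
  refine pauliCommute_of_mul_eq (conjTranspose_compress hX) (conjTranspose_compress hY) ?_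
  rw [← compress_mul hV hYe, ← compress_mul hV hXe, h]

theorem compressCoord_anticommute (hV : Vᴴ * V = 1) {X Y : Matrix m m ℂ} (hX : Xᴴ = X)
    (hY : Yᴴ = Y) (hXe : Commute X (V * Vᴴ)) (hYe : Commute Y (V * Vᴴ)) (h : X * Y + Y * X = 0) :
    PauliAnticommute (compressCoord V X) (compressCoord V Y) := by
  refine pauliAnticommute_of_mul_add_mul (conjTranspose_compress hX) (conjTranspose_compress hY) ?_
  rw [← compress_mul hV hYe, ← compress_mul hV hXe, ← Matrix.add_mul, ← Matrix.mul_add, h]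
  simp

/-- The Pauli coordinates of the pairs `(M, M')` with `β M + i M' ∈ S`. -/
noncomputable def coordPairs (B : ι → Matrix m m ℂ) (V : Matrix m (Fin 2) ℂ) (β : Matrix m m ℂ)
    (S : Submodule ℝ (Matrix m m ℂ)) : Submodule ℝ ((Fin 4 → ℝ) × (Fin 4 → ℝ)) :=
  (hermitianPairs B ⊓ S.comap (combinePair β)).map
    ((compressCoord V).prodMap (compressCoord V))

theorem commute_of_mem_hermitianPairs {e : Matrix m m ℂ}
    (he : ∀ X, (∀ k, Commute X (B (k, true) * B (k, false))) → Commute X e)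
    {p : Matrix m m ℂ × Matrix m m ℂ} (hp : p ∈ hermitianPairs B) :
    Commute p.1 e ∧ Commute p.2 e := by
  obtain ⟨-, -, h3, h4⟩ := hp
  refine ⟨he _ fun k => ?_, he _ fun k => ?_⟩ <;> rw [Commute, SemiconjBy]
  · linear_combination (norm := noncomm_ring) h3 (k, true) * B (k, false) +
      B (k, true) * h3 (k, false)
  · linear_combination (norm := noncomm_ring) h4 (k, true) * B (k, false) -
      B (k, true) * h4 (k, false)

/-- `S` is covered by the pairs that combine into it, and taking coordinates is injective on those
pairs by the faithfulness `hf`. -/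
theorem finrank_le_finrank_coordPairs (hV : Vᴴ * V = 1)
    (he : ∀ X, (∀ k, Commute X (B (k, true) * B (k, false))) → Commute X (V * Vᴴ))
    (hf : ∀ X, ((∀ x, X * B x = B x * X) ∨ (∀ x, X * B x = -(B x * X))) →
      X * (V * Vᴴ) = 0 → X = 0)
    {β : Matrix m m ℂ} {S : Submodule ℝ (Matrix m m ℂ)}
    (hS : ∀ X ∈ S, ∃ p ∈ hermitianPairs B, combinePair β p = X) :
    Module.finrank ℝ S ≤ Module.finrank ℝ (coordPairs B V β S) := by
  set P := hermitianPairs B ⊓ S.comap (combinePair β) with hP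
  have h1 : S ≤ P.map (combinePair β) := by
    intro X hX
    obtain ⟨p, hp, rfl⟩ := hS X hX
    exact ⟨p, ⟨hp, hX⟩, rfl⟩
  refine (Submodule.finrank_mono h1).trans ((Submodule.finrank_map_le _ _).trans (le_of_eq ?_))
  rw [coordPairs, ← hP, ← LinearMap.range_domRestrict]
  refine (LinearMap.finrank_range_of_inj ?_).symm
  rw [← LinearMap.ker_eq_bot, LinearMap.ker_eq_bot']
  rintro ⟨p, hp⟩ h0
  have hpe := commute_of_mem_hermitianPairs he hp.1
  have h0' : compressCoord V p.1 = 0 ∧ compressCoord V p.2 = 0 := by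
    simpa [LinearMap.prodMap_apply] using h0
  obtain ⟨⟨a1, a2, a3, a4⟩, -⟩ := hp
  ext1
  exact Prod.ext
    (eq_zero_of_compressCoord_eq_zero hV a1 hpe.1 (hf _ (Or.inl a3)) h0'.1)
    (eq_zero_of_compressCoord_eq_zero hV a2 hpe.2 (hf _ (Or.inr a4)) h0'.2)

theorem pauliRel_coordPairs (hV : Vᴴ * V = 1)
    (he : ∀ X, (∀ k, Commute X (B (k, true) * B (k, false))) → Commute X (V * Vᴴ))
    {β β' : Matrix m m ℂ} {S S' : Submodule ℝ (Matrix m m ℂ)}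
    (hrel : ∀ p ∈ hermitianPairs B, ∀ q ∈ hermitianPairs B, combinePair β p ∈ S →
      combinePair β' q ∈ S' → p.1 * q.1 = q.1 * p.1 ∧ p.1 * (Complex.I • q.2) = Complex.I • q.2 * p.1
        ∧ Complex.I • p.2 * q.1 = q.1 * (Complex.I • p.2) ∧
        Complex.I • p.2 * (Complex.I • q.2) + Complex.I • q.2 * (Complex.I • p.2) = 0) :
    ∀ x ∈ coordPairs B V β S, ∀ y ∈ coordPairs B V β' S', PauliRel x y := by
  rintro _ ⟨p, ⟨hp, hpS⟩, rfl⟩ _ ⟨q, ⟨hq, hqS⟩, rfl⟩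
  obtain ⟨r1, r2, r3, r4⟩ := hrel p hp q hq hpS hqS
  obtain ⟨p1, p2⟩ := commute_of_mem_hermitianPairs he hp
  obtain ⟨q1, q2⟩ := commute_of_mem_hermitianPairs he hq
  have hI := smul_right_injective (Matrix m m ℂ) Complex.I_ne_zero
  refine ⟨compressCoord_commute hV hp.1 hq.1 p1 q1 r1,
    compressCoord_commute hV hp.1 hq.2.1 p1 q2 (hI ?_),
    compressCoord_commute hV hp.2.1 hq.1 p2 q1 (hI ?_),
    compressCoord_anticommute hV hp.2.1 hq.2.1 p2 q2 ?_⟩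
  · change Complex.I • (p.1 * q.2) = Complex.I • (q.2 * p.1)
    simpa only [mul_smul_comm, smul_mul_assoc] using r2
  · change Complex.I • (p.2 * q.1) = Complex.I • (q.1 * p.2)
    simpa only [mul_smul_comm, smul_mul_assoc] using r3
  · simp only [mul_smul_comm, smul_mul_assoc, smul_smul, Complex.I_mul_I, neg_one_smul] at r4
    rw [← neg_eq_zero, neg_add]
    exact r4

variable [DecidableEq m]

/-- If `2 n + 1` groups of matrices of size `2 ^ (n + 1)` are mutually orthogonal in the sense of
Hurwitz and Radon, then not all of them span spaces of dimension at least three. -/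
theorem not_forall_three_le_finrank (hn : 1 ≤ n) (hm : Fintype.card m = 2 ^ (n + 1))
    (S : Option (Fin n × Bool) → Submodule ℝ (Matrix m m ℂ)) (h1 : 1 ∈ S none)
    (B : Fin n × Bool → Matrix m m ℂ) (hB : ∀ x, B x ∈ S (some x))
    (hBu : ∀ x, B x ∈ Matrix.unitaryGroup m ℂ)
    (hS : ∀ i j, i ≠ j → ∀ X ∈ S i, ∀ Y ∈ S j, Xᴴ * Y + Yᴴ * X = 0)
    (hr : ∀ i, 3 ≤ Module.finrank ℝ (S i)) : False := by
  have hskew : ∀ x, ∀ X ∈ S (some x), Xᴴ = -X := by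
    intro x X hX
    have := hS none (some x) (by simp) 1 h1 X hX
    simp only [Matrix.conjTranspose_one, one_mul, mul_one] at this
    exact eq_neg_of_add_eq_zero_right this
  have hsk : ∀ x, (B x)ᴴ = -B x := fun x => hskew x _ (hB x)
  have hsq : ∀ x, B x * B x = -1 := by
    intro x
    have := Matrix.mem_unitaryGroup_iff.1 (hBu x)
    rw [Matrix.star_eq_conjTranspose, hsk, mul_neg] at this
    rw [← this, neg_neg]
  have hanti : ∀ x y, x ≠ y → ∀ X ∈ S (some x), X * B y = -(B y * X) := by
    intro x y hxy X hX
    have := hS (some x) (some y) (by simpa using hxy) X hX _ (hB y)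
    rw [hskew x X hX, hsk] at this
    linear_combination (norm := noncomm_ring) (-1 : ℤ) • this
  have hac : ∀ x y, x ≠ y → B x * B y = -(B y * B x) := fun x y hxy =>
    hanti x y hxy _ (hB x)
  obtain ⟨e, e1, e2, e3, he, hf⟩ := exists_clifford_idempotent n B hsk hsq hac
  -- The size `2 ^ (n + 1)` leaves trace `2` after `n` halvings; hence the compression to 2 × 2
  -- matrices.
  have ht : e.trace = (2 : ℕ) := by
    rw [hm, pow_succ] at e3
    push_cast at e3 ⊢
    exact mul_left_cancel₀ (pow_ne_zero n two_ne_zero) e3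
  obtain ⟨V, hV, rfl⟩ := Matrix.exists_eq_mul_conjTranspose_of_isIdempotent e1 e2 ht
  have hdec0 : ∀ X ∈ S none, ∃ p ∈ hermitianPairs B, combinePair 1 p = X := by
    intro X hX
    have hXB : ∀ x, Xᴴ * B x = B x * X := by
      intro x
      have := hS none (some x) (by simp) X hX _ (hB x)
      rw [hsk] at this
      linear_combination (norm := noncomm_ring) this
    have hXB' : ∀ x, X * B x = B x * Xᴴ := by
      intro x
      linear_combination (norm := noncomm_ring) B x * hXB x * B x + hsq x * X * B x -
        B x * Xᴴ * hsq x
    -- Moving past a generator exchanges `X` and `Xᴴ`, so the Hermitian part commutes and the skew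
    -- part anticommutes.
    refine ⟨((1 / 2 : ℂ) • (X + Xᴴ), (-Complex.I / 2) • (X - Xᴴ)), ⟨?_, ?_, ?_, ?_⟩, ?_⟩
    · simp [add_comm]
    · simp only [Matrix.conjTranspose_smul, Matrix.conjTranspose_sub,
        Matrix.conjTranspose_conjTranspose]
      rw [← neg_sub X Xᴴ, smul_neg, ← neg_smul]
      simp [neg_div]
    · intro x
      simp only [smul_mul_assoc, mul_smul_comm, add_mul, mul_add, hXB, hXB', add_comm]
    · intro x
      simp only [smul_mul_assoc, mul_smul_comm, sub_mul, mul_sub, hXB, hXB', ← smul_neg, neg_sub]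
    · change 1 * ((1 / 2 : ℂ) • (X + Xᴴ)) + Complex.I • ((-Complex.I / 2) • (X - Xᴴ)) = X
      rw [one_mul, smul_smul, mul_div_assoc', mul_neg, Complex.I_mul_I, neg_neg, ← smul_add]
      rw [add_add_sub_cancel, ← two_smul ℂ X, smul_smul]
      norm_num
  have hdec : ∀ x, ∀ X ∈ S (some x), ∃ p ∈ hermitianPairs B, combinePair (B x) p = X := by
    intro x X hX
    have hXs := hskew x X hX
    -- `X` splits into the part `(X - B x * X * B x) / 2` commuting with `B x`, which is `B x * M`,
    -- and the anticommuting part `(X + B x * X * B x) / 2`, which is `i M'`.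
    refine ⟨((-1 / 2 : ℂ) • (B x * X + X * B x), (-Complex.I / 2) • (X + B x * X * B x)),
      ⟨?_, ?_, ?_, ?_⟩, ?_⟩
    · simp [hXs, hsk, add_comm]
    · simp only [Matrix.conjTranspose_smul, Matrix.conjTranspose_add, Matrix.conjTranspose_mul, hXs,
        hsk]
      rw [show -X + -B x * (-X * -B x) = -(X + B x * X * B x) by noncomm_ring, smul_neg, ← neg_smul]
      simp [neg_div]
    · intro y
      simp only [smul_mul_assoc, mul_smul_comm]
      congr 1
      by_cases hxy : x = y
      · subst hxy
        linear_combination (norm := noncomm_ring) X * hsq x - hsq x * X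
      · have a := hanti x y hxy X hX
        have b := hac x y hxy
        linear_combination (norm := noncomm_ring) B x * a - b * X + X * b - a * B x
    · intro y
      simp only [smul_mul_assoc, mul_smul_comm, ← smul_neg]
      congr 1
      by_cases hxy : x = y
      · subst hxy
        linear_combination (norm := noncomm_ring) B x * X * hsq x + hsq x * X * B x
      · have a := hanti x y hxy X hX
        have b := hac x y hxy
        linear_combination (norm := noncomm_ring) a + B x * X * b - B x * a * B x + b * X * B x
    · change B x * ((-1 / 2 : ℂ) • (B x * X + X * B x)) +
        Complex.I • ((-Complex.I / 2) • (X + B x * X * B x)) = X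
      have : B x * (B x * X + X * B x) = -X + B x * X * B x := by
        linear_combination (norm := noncomm_ring) hsq x * X
      rw [mul_smul_comm, this, smul_smul, mul_div_assoc', mul_neg, Complex.I_mul_I, neg_neg]
      module
  have hrel0 : ∀ x y, x ≠ y → ∀ p ∈ hermitianPairs B, ∀ q ∈ hermitianPairs B,
      combinePair 1 p ∈ S none → combinePair (B x) q ∈ S (some x) →
      p.1 * q.1 = q.1 * p.1 ∧ p.1 * (Complex.I • q.2) = Complex.I • q.2 * p.1
        ∧ Complex.I • p.2 * q.1 = q.1 * (Complex.I • p.2) ∧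
        Complex.I • p.2 * (Complex.I • q.2) + Complex.I • q.2 * (Complex.I • p.2) = 0 := by
    rintro x y hxy p ⟨p1, p2, p3, p4⟩ q ⟨q1, q2, q3, q4⟩ hp hq
    refine relations_of_add_mul_add (hsq x) (hsq y) (hac x y hxy) (p3 x) (p3 y) (q3 x) (q3 y)
      (by simp [p4]) (by simp [p4]) (by simp [q4]) (by simp [q4]) ?_
    have h := hS none (some x) (by simp) _ hp _ hq
    rw [hskew x _ hq] at h
    rw [neg_mul, ← sub_eq_add_neg] at h
    simpa [combinePair, p1, p2, ← sub_eq_add_neg] using h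
  have hrel : ∀ x y, x ≠ y → ∀ p ∈ hermitianPairs B, ∀ q ∈ hermitianPairs B,
      combinePair (B x) p ∈ S (some x) → combinePair (B y) q ∈ S (some y) →
      p.1 * q.1 = q.1 * p.1 ∧ p.1 * (Complex.I • q.2) = Complex.I • q.2 * p.1
        ∧ Complex.I • p.2 * q.1 = q.1 * (Complex.I • p.2) ∧
        Complex.I • p.2 * (Complex.I • q.2) + Complex.I • q.2 * (Complex.I • p.2) = 0 := by
    rintro x y hxy p ⟨p1, p2, p3, p4⟩ q ⟨q1, q2, q3, q4⟩ hp hq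
    refine relations_of_mul_add_mul_add (hsq x) (hsq y) (hac x y hxy) (p3 x) (p3 y) (q3 x) (q3 y)
      (by simp [p4]) (by simp [p4]) (by simp [q4]) (by simp [q4]) ?_
    have h := hS (some x) (some y) (by simpa using hxy) _ hp _ hq
    rw [hskew x _ hp, hskew y _ hq] at h
    rw [← neg_eq_zero, neg_add, ← neg_mul, ← neg_mul]
    exact h
  -- Three groups suffice for the contradiction; the other generators only serve to cut the
  -- commutant down to size two.
  have hxy : ((⟨0, hn⟩ : Fin n), true) ≠ (⟨0, hn⟩, false) := by simp
  exact not_pairwise_pauliRel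
    ((hr none).trans (finrank_le_finrank_coordPairs hV he hf hdec0))
    ((hr _).trans (finrank_le_finrank_coordPairs hV he hf (hdec (⟨0, hn⟩, true))))
    ((hr _).trans (finrank_le_finrank_coordPairs hV he hf (hdec (⟨0, hn⟩, false))))
    (pauliRel_coordPairs hV he (hrel0 _ _ hxy)) (pauliRel_coordPairs hV he (hrel0 _ _ hxy.symm))
    (pauliRel_coordPairs hV he (hrel _ _ hxy))

end PauliPairs

/-! ### Construction of a design with `2 * a - 2` groups. -/

theorem Matrix.trace_conjTranspose_mul_re_eq_zero {m : Type*} [Fintype m] {X Y : Matrix m m ℂ}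
    (h : (Xᴴ * Y + Yᴴ * X).trace = 0) : (Xᴴ * Y).trace.re = 0 := by
  have h1 : (Yᴴ * X).trace = star (Xᴴ * Y).trace := by
    rw [← Matrix.trace_conjTranspose]
    simp
  rw [Matrix.trace_add, h1] at h
  have := congrArg Complex.re h
  simp at this
  linarith

/-- The real part of `(Xᴴ * Y).trace` is a real inner product, for which the family is orthogonal
with nonzero norms. -/
theorem linearIndependent_of_trace_eq_zero {m ι : Type*} [Fintype m] [DecidableEq m] [Nonempty m]
    {W : ι → Matrix m m ℂ} (hW : ∀ i, W i ∈ Matrix.unitaryGroup m ℂ)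
    (h : ∀ i j, i ≠ j → ((W i)ᴴ * W j + (W j)ᴴ * W i).trace = 0) : LinearIndependent ℝ W := by
  rw [linearIndependent_iff']
  intro s c hc i hi
  have h1 : ((W i)ᴴ * ∑ j ∈ s, c j • W j).trace.re = 0 := by simp [hc]
  rw [Finset.mul_sum, Matrix.trace_sum, Complex.re_sum, Finset.sum_eq_single i] at h1
  · have h2 : (W i)ᴴ * W i = 1 := Matrix.mem_unitaryGroup_iff'.1 (hW i)
    rw [mul_smul_comm, h2, Matrix.trace_smul, Matrix.trace_one] at h1
    simpa using h1
  · intro j _ hj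
    rw [mul_smul_comm, Matrix.trace_smul, Complex.smul_re,
      Matrix.trace_conjTranspose_mul_re_eq_zero (h i j hj.symm), smul_zero]
  · exact fun h => absurd hi h

open scoped Kronecker in
/-- In dimension `2 ^ k` there are `2 k + 1` anticommuting skew-Hermitian unitary matrices. -/
theorem exists_anticommuting_family (k : ℕ) :
    ∃ (ι κ : Type) (_ : Fintype ι) (_ : DecidableEq ι) (_ : Fintype κ)
      (B : κ → Matrix ι ι ℂ), Fintype.card ι = 2 ^ k ∧ Fintype.card κ = 2 * k + 1 ∧
      (∀ x, (B x)ᴴ = -B x) ∧ (∀ x, B x * B x = -1) ∧ ∀ x y, x ≠ y → B x * B y + B y * B x = 0 := by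
  induction k with
  | zero =>
    refine ⟨Unit, Unit, inferInstance, inferInstance, inferInstance, fun _ => Complex.I • 1, by simp,
      by simp, ?_, ?_, ?_⟩
    · simp
    · intro x
      rw [smul_mul_smul_comm, Complex.I_mul_I]
      simp
    · intro x y h
      exact absurd rfl h
  | succ k ih =>
    obtain ⟨ι, κ, _, _, _, B, h1, h2, h3, h4, h5⟩ := ih
    let X : Matrix (Fin 2) (Fin 2) ℂ := !![0, Complex.I; Complex.I, 0]
    let Y : Matrix (Fin 2) (Fin 2) ℂ := !![0, 1; -1, 0]
    let Z : Matrix (Fin 2) (Fin 2) ℂ := !![1, 0; 0, -1]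
    have hX : Xᴴ = -X := by ext i j; fin_cases i <;> fin_cases j <;> simp [X]
    have hY : Yᴴ = -Y := by ext i j; fin_cases i <;> fin_cases j <;> simp [Y]
    have hZ : Zᴴ = Z := by ext i j; fin_cases i <;> fin_cases j <;> simp [Z]
    have hXX : X * X = -1 := by
      ext i j; fin_cases i <;> fin_cases j <;> simp [X]
    have hYY : Y * Y = -1 := by
      ext i j; fin_cases i <;> fin_cases j <;> simp [Y]
    have hZZ : Z * Z = 1 := by
      ext i j; fin_cases i <;> fin_cases j <;> simp [Z]
    have hXY : X * Y + Y * X = 0 := by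
      ext i j; fin_cases i <;> fin_cases j <;> simp [X, Y]
    have hXZ : X * Z + Z * X = 0 := by
      ext i j; fin_cases i <;> fin_cases j <;> simp [X, Z]
    have hYZ : Y * Z + Z * Y = 0 := by
      ext i j; fin_cases i <;> fin_cases j <;> simp [Y, Z]
    have neg_kron : ∀ (M : Matrix ι ι ℂ) (N : Matrix (Fin 2) (Fin 2) ℂ),
        (-M) ⊗ₖ N = -(M ⊗ₖ N) := fun M N => by ext; simp
    have kron_neg : ∀ (M : Matrix ι ι ℂ) (N : Matrix (Fin 2) (Fin 2) ℂ),
        M ⊗ₖ (-N) = -(M ⊗ₖ N) := fun M N => by ext; simp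
    -- `X`, `Y` are `i` times Pauli matrices and `Z` is the third one: doubling the size adds two
    -- generators, and the factor `Z` makes the old ones anticommute with them.
    refine ⟨ι × Fin 2, Option (Option κ), inferInstance, inferInstance, inferInstance,
      fun x => x.elim (1 ⊗ₖ X) fun x => x.elim (1 ⊗ₖ Y) fun x => B x ⊗ₖ Z, ?_, ?_, ?_, ?_, ?_⟩
    · simp [h1, pow_succ]
    · simp only [Fintype.card_option, h2]
      ring
    · rintro (_ | _ | x) <;> simp [Matrix.conjTranspose_kronecker, hX, hY, hZ, h3, neg_kron,
        kron_neg]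
    · rintro (_ | _ | x) <;> simp [← Matrix.mul_kronecker_mul, hXX, hYY, hZZ, h4, neg_kron,
        kron_neg]
    · rintro (_ | _ | x) (_ | _ | y) hxy <;>
        simp only [Option.elim_none, Option.elim_some, ← Matrix.mul_kronecker_mul, one_mul, mul_one,
          ne_eq, not_true_eq_false] at hxy ⊢
      · rw [← Matrix.kronecker_add, hXY, Matrix.kronecker_zero]
      · rw [← Matrix.kronecker_add, hXZ, Matrix.kronecker_zero]
      · rw [← Matrix.kronecker_add, add_comm, hXY, Matrix.kronecker_zero]
      · rw [← Matrix.kronecker_add, hYZ, Matrix.kronecker_zero]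
      · rw [← Matrix.kronecker_add, add_comm, hXZ, Matrix.kronecker_zero]
      · rw [← Matrix.kronecker_add, add_comm, hYZ, Matrix.kronecker_zero]
      · rw [← Matrix.add_kronecker, h5 x y (by simpa using hxy), Matrix.zero_kronecker]

/-- The signs on the diagonals of three trace-orthogonal diagonal `4 × 4` matrices. -/
def diagonalSigns : Fin 3 → Fin 4 → ℂ :=
  ![![1, 1, 1, 1], ![1, -1, 1, -1], ![1, 1, -1, -1]]

theorem star_diagonalSigns (i : Fin 3) : star (diagonalSigns i) = diagonalSigns i := by
  ext j
  fin_cases i <;> fin_cases j <;> simp [diagonalSigns]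

theorem diagonalSigns_mul_self (i : Fin 3) (j : Fin 4) :
    diagonalSigns i j * diagonalSigns i j = 1 := by
  fin_cases i <;> fin_cases j <;> simp [diagonalSigns]

theorem sum_diagonalSigns_mul {i j : Fin 3} (h : i ≠ j) :
    ∑ k, diagonalSigns i k * diagonalSigns j k = 0 := by
  fin_cases i <;> fin_cases j <;> simp [diagonalSigns, Fin.sum_univ_four] at h ⊢

open scoped Kronecker in
-- Sign diagonals are real and commute, so tensoring with them preserves orthogonality between
-- groups; their trace-orthogonality gives independence within a group.
theorem exists_unitary_three_group_family (k : ℕ) :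
    ∃ (m κ : Type) (_ : Fintype m) (_ : DecidableEq m) (_ : Fintype κ)
      (W : κ × Fin 3 → Matrix m m ℂ), Fintype.card m = 2 ^ (k + 2) ∧
      Fintype.card κ = 2 * k + 2 ∧ (∀ x, W x ∈ Matrix.unitaryGroup m ℂ) ∧
      LinearIndependent ℝ W ∧ ∀ x y, x.1 ≠ y.1 → (W x)ᴴ * W y + (W y)ᴴ * W x = 0 := by
  obtain ⟨ι, κ, _, _, _, B, h1, h2, h3, h4, h5⟩ := exists_anticommuting_family k
  let F : Option κ → Matrix ι ι ℂ := fun x => x.elim 1 B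
  have hF : ∀ x, (F x)ᴴ * F x = 1 := by
    rintro (_ | x) <;> simp [F, h3, h4]
  have hFF : ∀ x y, x ≠ y → (F x)ᴴ * F y + (F y)ᴴ * F x = 0 := by
    rintro (_ | x) (_ | y) hxy
    · exact absurd rfl hxy
    · simp [F, h3]
    · simp [F, h3]
    · simp only [F, Option.elim_some, h3, neg_mul]
      rw [← neg_add, h5 x y (by simpa using hxy), neg_zero]
  let W : Option κ × Fin 3 → Matrix (ι × Fin 4) (ι × Fin 4) ℂ :=
    fun x => F x.1 ⊗ₖ Matrix.diagonal (diagonalSigns x.2)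
  have hmul : ∀ x y, (W x)ᴴ * W y = ((F x.1)ᴴ * F y.1) ⊗ₖ
      Matrix.diagonal (fun k => diagonalSigns x.2 k * diagonalSigns y.2 k) := by
    intro x y
    simp only [W]
    rw [Matrix.conjTranspose_kronecker, ← Matrix.mul_kronecker_mul, Matrix.diagonal_conjTranspose,
      star_diagonalSigns, Matrix.diagonal_mul_diagonal]
  have hdist : ∀ x y, x.1 ≠ y.1 → (W x)ᴴ * W y + (W y)ᴴ * W x = 0 := by
    intro x y hxy
    rw [hmul, hmul]
    simp only [mul_comm (diagonalSigns y.2 _)]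
    rw [← Matrix.add_kronecker, hFF _ _ hxy, Matrix.zero_kronecker]
  have hun : ∀ x, W x ∈ Matrix.unitaryGroup (ι × Fin 4) ℂ := by
    intro x
    rw [Matrix.mem_unitaryGroup_iff', Matrix.star_eq_conjTranspose, hmul, hF]
    simp [diagonalSigns_mul_self]
  have : Nonempty ι := Fintype.card_pos_iff.1 (by rw [h1]; positivity)
  refine ⟨ι × Fin 4, Option κ, inferInstance, inferInstance, inferInstance, W, ?_, ?_, hun, ?_,
    hdist⟩
  · simp [h1, pow_succ, mul_assoc]
  · simp [h2]
  · refine linearIndependent_of_trace_eq_zero hun ?_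
    rintro ⟨x, i⟩ ⟨y, j⟩ hxy
    by_cases h : x = y
    · subst h
      have hij : i ≠ j := fun h => hxy (by rw [h])
      rw [hmul, hmul, Matrix.trace_add, Matrix.trace_kronecker, Matrix.trace_kronecker,
        Matrix.trace_diagonal, Matrix.trace_diagonal, sum_diagonalSigns_mul hij,
        sum_diagonalSigns_mul hij.symm]
      simp
    · rw [hdist _ _ h, Matrix.trace_zero]

theorem exists_lstd_three_groups (a : ℕ) (ha : 2 ≤ a) :
    ∃ X : LSTD (2 ^ a) ((2 * a - 2) * 3),
      X.IsUnitaryWeight ∧ X.IsGroupDecodable (2 * a - 2) 3 := by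
  obtain ⟨k, rfl⟩ := Nat.exists_eq_add_of_le' ha
  obtain ⟨m, κ, _, _, _, W, h1, h2, h3, h4, h5⟩ := exists_unitary_three_group_family k
  have hg : 2 * (k + 2) - 2 = 2 * k + 2 := by omega
  rw [hg]
  let e : m ≃ Fin (2 ^ (k + 2)) := Fintype.equivFinOfCardEq h1
  let f : Fin (2 * k + 2) ≃ κ := (Fintype.equivFinOfCardEq h2).symm
  let φ : Fin ((2 * k + 2) * 3) → κ × Fin 3 := fun i =>
    (f (finProdFinEquiv.symm i).1, (finProdFinEquiv.symm i).2)
  have hφ : Function.Injective φ := by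
    intro i j hij
    simp only [φ, Prod.mk.injEq, EmbeddingLike.apply_eq_iff_eq] at hij
    exact finProdFinEquiv.symm.injective (Prod.ext hij.1 hij.2)
  refine ⟨⟨fun i => Matrix.reindexLinearEquiv ℝ ℂ e e (W (φ i)), ?_⟩, ?_, ?_⟩
  · exact (h4.comp φ hφ).map' (Matrix.reindexLinearEquiv ℝ ℂ e e).toLinearMap
      (LinearEquiv.ker _)
  · intro i
    have := Matrix.mem_unitaryGroup_iff'.1 (h3 (φ i))
    rw [Matrix.mem_unitaryGroup_iff']
    simp only [Matrix.coe_reindexLinearEquiv, Matrix.reindex_apply, Matrix.star_eq_conjTranspose,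
      Matrix.conjTranspose_submatrix, Matrix.submatrix_mul_equiv] at this ⊢
    rw [this, Matrix.submatrix_one_equiv]
  · refine ⟨fun i => (finProdFinEquiv.symm i).1, fun i => ?_, fun i j hij => ?_⟩
    · have e1 : {l : Fin ((2 * k + 2) * 3) // (finProdFinEquiv.symm l).1 = i} ≃ Fin 3 :=
        { toFun := fun l => (finProdFinEquiv.symm l.1).2
          invFun := fun j => ⟨finProdFinEquiv (i, j), by simp⟩
          left_inv := by
            rintro ⟨l, rfl⟩
            exact Subtype.ext (finProdFinEquiv.apply_symm_apply l)
          right_inv := fun j => by simp }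
      rw [Fintype.card_congr e1, Fintype.card_fin]
    · have := h5 (φ i) (φ j) (fun h => hij (f.injective h))
      simp only [Matrix.coe_reindexLinearEquiv, Matrix.reindex_apply,
        Matrix.conjTranspose_submatrix, Matrix.submatrix_mul_equiv]
      exact congrArg (fun M => M.submatrix e.symm e.symm) this

/-! ### Bounding the number of groups of a design. -/

theorem orthogonal_of_mem_span {m : Type*} [Fintype m] {s t : Set (Matrix m m ℂ)}
    (h : ∀ x ∈ s, ∀ y ∈ t, xᴴ * y + yᴴ * x = 0) :
    ∀ x ∈ Submodule.span ℝ s, ∀ y ∈ Submodule.span ℝ t, xᴴ * y + yᴴ * x = 0 := by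
  intro x hx y hy
  induction hx, hy using Submodule.span_induction₂ with
  | mem_mem x y hx hy => exact h x hx y hy
  | zero_left y hy => simp
  | zero_right x hx => simp
  | add_left x y z _ _ _ h1 h2 =>
    rw [Matrix.conjTranspose_add, Matrix.add_mul, Matrix.mul_add, add_add_add_comm, h1, h2, add_zero]
  | add_right x y z _ _ _ h1 h2 =>
    rw [Matrix.conjTranspose_add, Matrix.add_mul, Matrix.mul_add, add_add_add_comm, h1, h2, add_zero]
  | smul_left r x y _ _ h => simp [← smul_add, h]
  | smul_right r x y _ _ h => simp [← smul_add, h]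

/-- Left multiplication by the unitary `Uᴴ` preserves all products `Aᴴ * A'` and linear
independence, so one weight matrix may be taken to be `1`. -/
theorem LSTD.IsGroupDecodable.le_two_mul_sub_two {a : ℕ} (ha : 2 ≤ a) {K g : ℕ}
    {X : LSTD (2 ^ a) K} (hX : X.IsUnitaryWeight) (hg : X.IsGroupDecodable g 3) :
    g ≤ 2 * a - 2 := by
  obtain ⟨grp, hcard, hrel⟩ := hg
  by_contra hlt
  obtain ⟨n, rfl⟩ := Nat.exists_eq_add_of_le' (show 1 ≤ a by omega)
  -- With `a = n + 1`, exceeding `2 * a - 2 = 2 * n` leaves room for `2 * n + 1` groups: the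
  -- normalised one and `2 * n` generators.
  obtain ⟨f⟩ : Nonempty (Option (Fin n × Bool) ↪ Fin g) :=
    Function.Embedding.nonempty_of_card_le (by simp; omega)
  have hrep : ∀ i : Fin g, ∃ k, grp k = i := by
    intro i
    obtain ⟨k, hk⟩ := Fintype.card_pos_iff.1 (show 0 < Fintype.card {k // grp k = i} by
      rw [hcard]; norm_num)
    exact ⟨k, hk⟩
  choose r hr using hrep
  set U := X.weight (r (f none)) with hU
  have hUU : U * Uᴴ = 1 := Matrix.mem_unitaryGroup_iff.1 (hX _)
  have hUU' : Uᴴ * U = 1 := Matrix.mem_unitaryGroup_iff'.1 (hX _)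
  have hprod : ∀ A A' : Matrix (Fin (2 ^ (n + 1))) (Fin (2 ^ (n + 1))) ℂ,
      (Uᴴ * A)ᴴ * (Uᴴ * A') = Aᴴ * A' := by
    intro A A'
    rw [Matrix.conjTranspose_mul, Matrix.conjTranspose_conjTranspose, mul_assoc, ← mul_assoc U, hUU,
      one_mul]
  let S : Option (Fin n × Bool) → Submodule ℝ (Matrix (Fin (2 ^ (n + 1))) (Fin (2 ^ (n + 1))) ℂ) :=
    fun i => Submodule.span ℝ (Set.range fun k : {k // grp k = f i} => Uᴴ * X.weight k)
  have hmem : ∀ i, Uᴴ * X.weight (r (f i)) ∈ S i := fun i =>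
    Submodule.subset_span ⟨⟨r (f i), hr _⟩, rfl⟩
  have hli : LinearIndependent ℝ fun k => Uᴴ * X.weight k := by
    refine X.linearIndependent.map' (LinearMap.mulLeft ℝ Uᴴ) (LinearMap.ker_eq_bot.2 ?_)
    intro A A' h
    have := congrArg (fun M => U * M) (show Uᴴ * A = Uᴴ * A' from h)
    simpa [← mul_assoc, hUU] using this
  refine not_forall_three_le_finrank (by omega) (by simp) S ?_
    (fun x => Uᴴ * X.weight (r (f (some x)))) (fun x => hmem _) ?_ ?_ ?_
  · have := hmem none
    rwa [← hU, hUU'] at this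
  · intro x
    rw [Matrix.mem_unitaryGroup_iff', Matrix.star_eq_conjTranspose, hprod]
    exact Matrix.mem_unitaryGroup_iff'.1 (hX _)
  · intro i j hij
    refine orthogonal_of_mem_span ?_
    rintro _ ⟨k, rfl⟩ _ ⟨l, rfl⟩
    simp only [hprod]
    exact hrel _ _ (by rw [k.2, l.2]; exact fun h => hij (f.injective h))
  · intro i
    have := finrank_span_eq_card (hli.comp _ (Subtype.val_injective (p := fun k => grp k = f i)))
    rw [hcard] at this
    exact this.ge

theorem LSTD.IsGroupDecodable.card_eq {N K g lam : ℕ} {X : LSTD N K}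
    (h : X.IsGroupDecodable g lam) : K = g * lam := by
  obtain ⟨grp, hcard, -⟩ := h
  have := Fintype.card_congr (Equiv.sigmaFiberEquiv grp)
  rw [Fintype.card_sigma, Finset.sum_congr rfl fun i _ => hcard i] at this
  simpa using this.symm

theorem theorem3 (a : ℕ) (ha : 2 ≤ a) :
    IsGreatest
      {R : ℝ | ∃ (K : ℕ) (X : LSTD (2 ^ a) K),
        X.IsUnitaryWeight ∧ X.IsRealSymbolDecodable 3 ∧ X.rate = R}
      (3 * ((a : ℝ) - 1) / 2 ^ a) ∧
    IsGreatest
      {g : ℕ | ∃ (K : ℕ) (X : LSTD (2 ^ a) K),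
        X.IsUnitaryWeight ∧ X.IsGroupDecodable g 3}
      (2 * a - 2) := by
  obtain ⟨X, hX, hXg⟩ := exists_lstd_three_groups a ha
  have hcast : ((2 * a - 2 : ℕ) : ℝ) = 2 * a - 2 := by
    rw [Nat.cast_sub (by omega)]
    push_cast
    ring
  refine ⟨⟨⟨_, X, hX, ⟨_, hXg⟩, ?_⟩, ?_⟩, ⟨_, X, hX, hXg⟩, ?_⟩
  · rw [LSTD.rate, Nat.cast_mul, hcast]
    push_cast
    field_simp
  · rintro _ ⟨K, Y, hY, ⟨g, hg⟩, rfl⟩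
    have h1 : (g : ℝ) ≤ 2 * a - 2 := by
      rw [← hcast]
      exact_mod_cast hg.le_two_mul_sub_two ha hY
    rw [LSTD.rate, hg.card_eq]
    push_cast
    rw [div_le_div_iff₀ (by positivity) (by positivity)]
    have h2 : (0 : ℝ) < 2 ^ a := by positivity
    nlinarith
  · rintro g ⟨K, Y, hY, hg⟩
    exact hg.le_two_mul_sub_two ha hY
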